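/- **Theorem (conservative unfolding).** Let $(\mathbf C,\mathcal M)$ be an $\mathcal M$-adhesive category (pushouts along $\mathcal M$-morphisms are van Kampen for cubes with vertical morphisms in $\mathcal M$) with binary coproducts and a unique $\mathcal E'$-$\mathcal M$ pair factorization, $\mathcal E'$ closed under isomorphisms. Application conditions (ACs) over $P$ are built from $\exists(a\colon P\to C, c)$ by negation and conjunction (here with index sets of any size); $p\colon P\to G$ satisfies $\exists(a,c)$ if some $q\in\mathcal M$ has $q\circ a=p$ and $q\models c$; $\exists a$ is $\exists(a,\mathrm{true})$. Two ACs are equivalent if the same morphisms satisfy them. A rule $\rho=\langle L\hookleftarrow I\hookrightarrow R,\ ac_L\rangle$ consists of $\mathcal M$-morphisms and an AC; an AC-disregarding (plain) direct transformation is a double pushout, and a direct transformation via $\rho$ is one whose match satisfies $ac_L$. A plain transformation pair $P_1\Leftarrow K\Rightarrow P_2$ with matches $o_i\colon L_i\to K$, comatches $o_i'\colon R_i\to P_i$ and derived spans $K\xleftarrow{k_i}D_i\xrightarrow{c_i}P_i$ is *parallel independent* if there are $d_{12}\colon L_1\to D_2$ and $d_{21}\colon L_2\to D_1$ with $k_2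 d_{12}=o_1$ and $k_1 d_{21}=o_2$; for a pair of transformations via $\rho_1,\rho_2$ one requires also $c_2d_{12}\models ac_{L_1}$ and $c_1d_{21}\models ac_{L_2}$. A *conflict* is a pair of (plain or AC-respecting) transformations that is not parallel independent in the respective sense. A pair is embedded into another by an extension morphism between the source objects together with extension diagrams. A plain pair $tp^I$ is *initial* for $tp$ if it embeds into $tp$ via some $f^I$ and, whenever $tp'$ embeds into $tp$ via $f$, there is a unique embedding of $tp^I$ into $tp'$, via $f'$ say, with $f f'=f^I$. $\mathrm{Shift}(b,-)$ and $\mathrm{Left}(p,-)$ commute with negation and conjunction. $\mathrm{Shift}(b,\exists(a,c))=\bigvee\exists(a',\mathrm{Shift}(b',c))$ over all $(a',b')\in\mathcal E'$ with $b'\in\mathcal M$ and $a'b=b'a$. For a rule $p=(L\leftarrow I\to R)$, if $a\colon R\to X$ has a pushout complement $I\to Z\to X$ of $I\to R$, then $\mathrm{Left}(p,\exists(a,c))=\exists(b,\mathrm{Left}(p^*,c))$, where $L\xrightarrow{b}Y\leftarrow Z$ is the pushout of $L\leftarrow I\to Z$ and $p^*=(Y\leftarrow Z\to X)$; otherwise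 it is false. A *symbolic transformation pair* $stp_K=\langle tp_K,ac_K,ac_K^*\rangle$ consists of an AC-disregarding pair $tp_K$ as above, $ac_K=\mathrm{Shift}(o_1,ac_{L_1})\wedge\mathrm{Shift}(o_2,ac_{L_2})$ and $ac^*_K=\neg(ac^*_{12}\wedge ac^*_{21})$, where $ac^*_{12}=\mathrm{Left}(K\leftarrow D_2\to P_2,\mathrm{Shift}(c_2d_{12},ac_{L_1}))$ if $d_{12}$ exists and false otherwise, and symmetrically for $ac^*_{21}$. It is an *initial conflict* if (i) $tp_K$ embeds into some conflict via $\rho_1,\rho_2$, and (ii) $tp_K$ is either a plain conflict isomorphic to an initial pair for itself, or isomorphic to the coproduct pair $R_1+L_2\Leftarrow L_1+L_2\Rightarrow L_1+R_2$. Let $\mathcal R$ be a set of rules such that for every plain conflict between (the plain rules of) two rules of $\mathcal R$ there is an initial pair. Let $\rho_1,\rho_2\in\mathcal R$ have ACs $ac_{L_i}=\bigwedge_{j\in J_i}\neg\exists(n_{i,j}\colon L_i\to N_{i,j})$ with $J_i$ finite, and let $stp_K$ be an initial conflict for $(\rho_1,\rho_2)$. Choose literals as follows. Let $A$ be the family of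 morphisms $a\colon K\to C$ such that: * if $d_{12}$ and $d_{21}$ both exist (so $ac_K^*$ is a disjunction of positive conditions $\exists a$): the $\exists a$ are the disjuncts, obtained by applying $\mathrm{Left}(K\leftarrow D_2\to P_2,\cdot)$ to the disjuncts of $\mathrm{Shift}(c_2d_{12},\exists n_{1,j})$ and $\mathrm{Left}(K\leftarrow D_1\to P_1,\cdot)$ to the disjuncts of $\mathrm{Shift}(c_1d_{21},\exists n_{2,j})$; * otherwise (so $ac_K^*$ is true): $a$ ranges over all $a\colon K\to C$ with $(a,a)\in\mathcal E'$, among them $\mathrm{id}_K$. For $a\in A$ let $c_a$ be the conjunction of all NACs obtained by shifting over $a$ the NACs whose conjunction is $ac_K$; drop those $a$ for which one of the NAC morphisms in $c_a$ is an isomorphism. Let $A_0$ be the family of remaining morphisms. Then: 1. $A_0$ is non-empty and $ac_K\wedge ac_K^*$ is equivalent to $\bigvee_{a\in A_0}\exists(a,c_a)$; that is, $stp_K$ is regular, with these literals. 2. Let $\mathcal U^D(stp_K)$ be the set of all pairs of direct transformations via $\rho_1,\rho_2$ with matches $a\circ o_1$, $a\circ o_2$, $a\in A_0$ (the disjunctive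 unfolding). Every element of $\mathcal U^D(stp_K)$ is a conflict, and it is a critical pair for rules with NACs. That is, writing now $m_i$, $m_i'$ for its matches and comatches and $G\xleftarrow{k_i}D_i\xrightarrow{c_i}H_i$ for its derived spans, both matches satisfy the NACs and at least one of the following holds: * (1a) no $h_{12}\colon L_1\to D_2$ satisfies $k_2h_{12}=m_1$, and $(m_1,m_2)\in\mathcal E'$; * (1b) there are $h_{12}\colon L_1\to D_2$ with $k_2h_{12}=m_1$, an index $j$ and $q_{12}\colon N_{1,j}\to H_2$ in $\mathcal M$ with $q_{12}n_{1,j}=c_2h_{12}$ and $(q_{12},m_2')\in\mathcal E'$; * (2a) no $h_{21}\colon L_2\to D_1$ satisfies $k_1h_{21}=m_2$, and $(m_1,m_2)\in\mathcal E'$; * (2b) there are $h_{21}\colon L_2\to D_1$ with $k_1h_{21}=m_2$, an index $j$ and $q_{21}\colon N_{2,j}\to H_1$ in $\mathcal M$ with $q_{21}n_{2,j}=c_1h_{21}$ and $(q_{21},m_1')\in\mathcal E'$. -/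

import Mathlib

open CategoryTheory CategoryTheory.Limits

universe v u

namespace InitialConflicts

/-! ## `M`-adhesive categories and `E'`-`M` pair factorizations -/

/-- `M`-van Kampen squares: the van Kampen property for cubes over the given pushout square whose
vertical morphisms belong to `M`. -/
def IsMVanKampen {C : Type u} [Category.{v} C] (M : MorphismProperty C) {W X Y Z : C}
    {f : W ⟶ X} {g : W ⟶ Y} {h : X ⟶ Z} {i : Y ⟶ Z} (_ : IsPushout f g h i) : Prop :=
  ∀ ⦃W' X' Y' Z' : C⦄ (f' : W' ⟶ X') (g' : W' ⟶ Y') (h' : X' ⟶ Z') (i' : Y' ⟶ Z')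
    (αW : W' ⟶ W) (αX : X' ⟶ X) (αY : Y' ⟶ Y) (αZ : Z' ⟶ Z),
    M αX → M αY → M αZ →
    IsPullback f' αW αX f → IsPullback g' αW αY g →
    CommSq h' αX αZ h → CommSq i' αY αZ i → CommSq f' g' h' i' →
    (IsPushout f' g' h' i' ↔ IsPullback h' αX αZ h ∧ IsPullback i' αY αZ i)

/-- `(C, M)` is an `M`-adhesive category. Isomorphisms lie in `M`, since `M` contains the
identities and is stable under base change. -/
class MAdhesive {C : Type u} [Category.{v} C] (M : MorphismProperty C) : Prop where
  mono : M ≤ MorphismProperty.monomorphisms C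
  isMultiplicative : M.IsMultiplicative
  /-- closure under decomposition: `f ≫ g ∈ M` and `g ∈ M` imply `f ∈ M` -/
  decomposition : M.HasOfPostcompProperty M
  hasPushout : ∀ {X Y Z : C} (m : X ⟶ Y) (f : X ⟶ Z), M m → HasPushout m f
  hasPullback : ∀ {X Y Z : C} (m : X ⟶ Z) (f : Y ⟶ Z), M m → HasPullback m f
  stableUnderPushout : M.IsStableUnderCobaseChange
  stableUnderPullback : M.IsStableUnderBaseChange
  vanKampen : ∀ {W X Y Z : C} {m : W ⟶ X} {g : W ⟶ Y} {h : X ⟶ Z} {i : Y ⟶ Z}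
    (sq : IsPushout m g h i), M m → IsMVanKampen M sq

/-- A class of pairs of morphisms with the same codomain. -/
abbrev PairClass (C : Type u) [Category.{v} C] : Type (max u v) :=
  ∀ ⦃A B X : C⦄, (A ⟶ X) → (B ⟶ X) → Prop

/-- `C` has a unique `E'`-`M` pair factorization (`E'` being closed under isomorphisms). -/
structure HasPairFactorization {C : Type u} [Category.{v} C] (E' : PairClass C)
    (M : MorphismProperty C) : Prop where
  comp_iso : ∀ {A B X Y : C} (f : A ⟶ X) (g : B ⟶ X) (i : X ⟶ Y) [IsIso i],
    E' f g → E' (f ≫ i) (g ≫ i)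
  exists_factorization : ∀ {A B G : C} (f : A ⟶ G) (g : B ⟶ G),
    ∃ (K : C) (e₁ : A ⟶ K) (e₂ : B ⟶ K) (m : K ⟶ G),
      E' e₁ e₂ ∧ M m ∧ e₁ ≫ m = f ∧ e₂ ≫ m = g
  unique_factorization : ∀ {A B G K K' : C} (e₁ : A ⟶ K) (e₂ : B ⟶ K) (m : K ⟶ G)
    (e₁' : A ⟶ K') (e₂' : B ⟶ K') (m' : K' ⟶ G), E' e₁ e₂ → M m → E' e₁' e₂' → M m' →
    e₁ ≫ m = e₁' ≫ m' → e₂ ≫ m = e₂' ≫ m' →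
    ∃ i : K ≅ K', e₁ ≫ i.hom = e₁' ∧ e₂ ≫ i.hom = e₂' ∧ i.hom ≫ m' = m

/-! ## Application conditions -/

/-- Nested application conditions over an object. -/
inductive AC {C : Type u} [Category.{v} C] : C → Type (max u v + 1)
  | ex {P Q : C} (a : P ⟶ Q) (c : AC Q) : AC P
  | neg {P : C} (c : AC P) : AC P
  | conj {P : C} (ι : Type (max u v)) (c : ι → AC P) : AC P

namespace AC

variable {C : Type u} [Category.{v} C]

/-- The empty conjunction. -/
def tt (P : C) : AC P := conj PEmpty (fun x => x.elim)

def ff (P : C) : AC P := neg (tt P)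

def disj {P : C} (ι : Type (max u v)) (c : ι → AC P) : AC P :=
  neg (conj ι fun i => neg (c i))

def and {P : C} (c₁ c₂ : AC P) : AC P :=
  conj (ULift.{max u v} Bool) fun b => if b.down then c₁ else c₂

/-- `p` satisfies an application condition; extensions are sought in `M`. -/
def Sat (M : MorphismProperty C) : {P : C} → AC P → {G : C} → (P ⟶ G) → Prop
  | _, ex (Q := Q) a c, G, p => ∃ q : Q ⟶ G, M q ∧ a ≫ q = p ∧ Sat M c q
  | _, neg c, _, p => ¬ Sat M c p
  | _, conj _ c, _, p => ∀ i, Sat M (c i) p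

/-- Two conditions are equivalent if the same morphisms satisfy them. -/
def Equivalent (M : MorphismProperty C) {P : C} (c c' : AC P) : Prop :=
  ∀ ⦃G : C⦄ (p : P ⟶ G), c.Sat M p ↔ c'.Sat M p

end AC

/-- The completions of `N ⟵n- P -b⟶ P'` to a commutative square by a pair `(a', b')` in `E'`
with `b'` in `M`; these index the shift of `∃ n` over `b`. -/
structure ShiftSquare {C : Type u} [Category.{v} C] (E' : PairClass C) (M : MorphismProperty C)
    {P P' N : C} (b : P ⟶ P') (n : P ⟶ N) where
  X : C
  a' : P' ⟶ X
  b' : N ⟶ X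
  mem_E' : E' a' b'
  mem_M : M b'
  comm : n ≫ b' = b ≫ a'

/-- `L ⟵l- I -r⟶ R` is applied backwards along `a : R ⟶ X`: a pushout complement `Z` of `r` and
`a`, and the pushout `Y` of `l` along `I ⟶ Z`. The lower row `Y ⟵ Z ⟶ X` is the derived rule. -/
structure DerivedSpan {C : Type u} [Category.{v} C] {L I R X : C}
    (l : I ⟶ L) (r : I ⟶ R) (a : R ⟶ X) where
  Z : C
  Y : C
  z : I ⟶ Z
  b : L ⟶ Y
  l' : Z ⟶ Y
  r' : Z ⟶ X
  right : IsPushout r z a r'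
  left : IsPushout l z b l'

namespace AC

variable {C : Type u} [Category.{v} C]

/-- Shift of a condition over a morphism:
`Shift(b, ∃(a, c)) = ⋁ ∃(a', Shift(b', c))` over all `(a', b')` in `E'` with `b'` in `M` that
complete `b` and `a` to a commutative square. -/
def shift (E' : PairClass C) (M : MorphismProperty C) :
    {P : C} → AC P → {P' : C} → (P ⟶ P') → AC P'
  | _, ex a c, _, b =>
      disj (ShiftSquare E' M b a) fun s => ex s.a' (shift E' M c s.b')
  | _, neg c, _, b => neg (shift E' M c b)
  | _, conj ι c, _, b => conj ι fun i => shift E' M (c i) b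

open Classical in
/-- Shift of a condition on `R` over the rule `L ⟵l- I -r⟶ R` to a condition on `L`:
`Left(p, ∃(a, c)) = ∃(b, Left(p*, c))` if `a` has a pushout complement, with derived rule `p*`,
and `false` otherwise. -/
noncomputable def left : {R : C} → AC R → {L I : C} → (I ⟶ L) → (I ⟶ R) → AC L
  | _, ex a c, L, _, l, r =>
      if h : Nonempty (DerivedSpan l r a) then ex h.some.b (left c h.some.l' h.some.r') else ff L
  | _, neg c, _, _, l, r => neg (left c l r)
  | _, conj ι c, _, _, l, r => conj ι fun i => left (c i) l r

end AC

/-! ## Rules, transformations, extension diagrams -/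

structure PlainRule {C : Type u} [Category.{v} C] (M : MorphismProperty C) where
  L : C
  I : C
  R : C
  l : I ⟶ L
  r : I ⟶ R
  mem_l : M l
  mem_r : M r

structure Rule {C : Type u} [Category.{v} C] (M : MorphismProperty C) extends PlainRule M where
  ac : AC L

section Transformations

variable {C : Type u} [Category.{v} C] {M : MorphismProperty C}

/-- A plain (equivalently, AC-disregarding) direct transformation of `G`: a double pushout
with match `m`, comatch `m'` and derived span `G ⟵k- D -c⟶ H`. -/
structure DirectTransformation (p : PlainRule M) (G : C) where
  D : C
  H : C
  m : p.L ⟶ G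
  d : p.I ⟶ D
  m' : p.R ⟶ H
  k : D ⟶ G
  c : D ⟶ H
  pushout_left : IsPushout p.l d m k
  pushout_right : IsPushout p.r d m' c

/-- A pair of plain (equivalently, AC-disregarding) direct transformations of the same object. -/
structure TransformationPair (p₁ p₂ : PlainRule M) where
  G : C
  t₁ : DirectTransformation p₁ G
  t₂ : DirectTransformation p₂ G

/-- Both matches satisfy the application conditions, i.e. the pair is a pair of direct
transformations via the rules with application conditions. -/
def SatisfiesACs (ρ₁ ρ₂ : Rule M) (tp : TransformationPair ρ₁.toPlainRule ρ₂.toPlainRule) :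
    Prop :=
  ρ₁.ac.Sat M tp.t₁.m ∧ ρ₂.ac.Sat M tp.t₂.m

def ParallelIndependent (ρ₁ ρ₂ : Rule M)
    (tp : TransformationPair ρ₁.toPlainRule ρ₂.toPlainRule) : Prop :=
  (∃ d₁₂ : ρ₁.L ⟶ tp.t₂.D, d₁₂ ≫ tp.t₂.k = tp.t₁.m ∧ ρ₁.ac.Sat M (d₁₂ ≫ tp.t₂.c)) ∧
  (∃ d₂₁ : ρ₂.L ⟶ tp.t₁.D, d₂₁ ≫ tp.t₁.k = tp.t₂.m ∧ ρ₂.ac.Sat M (d₂₁ ≫ tp.t₁.c))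

/-- A conflict: a parallel dependent pair of direct transformations via rules with
application conditions. -/
def IsConflict (ρ₁ ρ₂ : Rule M) (tp : TransformationPair ρ₁.toPlainRule ρ₂.toPlainRule) : Prop :=
  SatisfiesACs ρ₁ ρ₂ tp ∧ ¬ ParallelIndependent ρ₁ ρ₂ tp

def PlainParallelIndependent {p₁ p₂ : PlainRule M} (tp : TransformationPair p₁ p₂) : Prop :=
  (∃ d₁₂ : p₁.L ⟶ tp.t₂.D, d₁₂ ≫ tp.t₂.k = tp.t₁.m) ∧
  (∃ d₂₁ : p₂.L ⟶ tp.t₁.D, d₂₁ ≫ tp.t₁.k = tp.t₂.m)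

/-- An extension diagram over the extension morphism `f`. -/
structure ExtensionDiagram {p : PlainRule M} {G G' : C} (t : DirectTransformation p G)
    (t' : DirectTransformation p G') (f : G ⟶ G') where
  fD : t.D ⟶ t'.D
  fH : t.H ⟶ t'.H
  comm_m : t.m ≫ f = t'.m
  comm_d : t.d ≫ fD = t'.d
  comm_m' : t.m' ≫ fH = t'.m'
  pushout_left : IsPushout t.k fD f t'.k
  pushout_right : IsPushout t.c fD fH t'.c

/-- An embedding of transformation pairs via extension diagrams. -/
structure Embedding {p₁ p₂ : PlainRule M} (tp tp' : TransformationPair p₁ p₂) where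
  f : tp.G ⟶ tp'.G
  e₁ : ExtensionDiagram tp.t₁ tp'.t₁ f
  e₂ : ExtensionDiagram tp.t₂ tp'.t₂ f

def Isomorphic {p₁ p₂ : PlainRule M} (tp tp' : TransformationPair p₁ p₂) : Prop :=
  ∃ e : Embedding tp tp', IsIso e.f ∧ IsIso e.e₁.fD ∧ IsIso e.e₁.fH ∧ IsIso e.e₂.fD ∧
    IsIso e.e₂.fH

/-! ## Initial conflicts -/

/-- `tpI` is an initial transformation pair for `tp`. -/
def IsInitialFor {p₁ p₂ : PlainRule M} (tpI tp : TransformationPair p₁ p₂) : Prop :=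
  ∃ eI : Embedding tpI tp, ∀ (tp' : TransformationPair p₁ p₂) (e : Embedding tp' tp),
    ∃! e' : Embedding tpI tp', e'.f ≫ e.f = eI.f

/-- The system with rule set `R` has initial transformation pairs for conflicts along plain
rules. -/
def HasInitialTransformationPairs (R : Set (Rule M)) : Prop :=
  ∀ ρ₁ ∈ R, ∀ ρ₂ ∈ R, ∀ tp : TransformationPair ρ₁.toPlainRule ρ₂.toPlainRule,
    ¬ PlainParallelIndependent tp → ∃ tpI, IsInitialFor tpI tp

def IsPlainInitialConflict {p₁ p₂ : PlainRule M} (tp : TransformationPair p₁ p₂) : Prop :=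
  ¬ PlainParallelIndependent tp ∧ ∃ tpI, IsInitialFor tpI tp ∧ Isomorphic tp tpI

theorem isPushout_coprod_inr [HasBinaryCoproducts C] {A B : C} (f : A ⟶ B) (X : C) :
    IsPushout f (coprod.inr : A ⟶ X ⨿ A) (coprod.inr : B ⟶ X ⨿ B) (coprod.map (𝟙 X) f) := by
  refine ⟨⟨by rw [coprod.inr_map]⟩, ⟨PushoutCocone.IsColimit.mk _
    (fun s => coprod.desc (coprod.inl ≫ s.inr) s.inl) (fun s => by rw [coprod.inr_desc]) ?_ ?_⟩⟩
  · intro s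
    apply coprod.hom_ext
    · rw [coprod.inl_map_assoc, Category.id_comp, coprod.inl_desc]
    · rw [coprod.inr_map_assoc, coprod.inr_desc, s.condition]
  · intro s m h₁ h₂
    apply coprod.hom_ext
    · rw [coprod.inl_desc, ← h₂, coprod.inl_map_assoc, Category.id_comp]
    · rw [coprod.inr_desc, h₁]

/-- The transformation pair `R₁ + L₂ ⟸ L₁ + L₂ ⟹ L₁ + R₂`. -/
noncomputable def coproductPair [HasBinaryCoproducts C] (p₁ p₂ : PlainRule M) :
    TransformationPair p₁ p₂ where
  G := p₁.L ⨿ p₂.L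
  t₁ :=
    { D := p₁.I ⨿ p₂.L
      H := p₁.R ⨿ p₂.L
      m := coprod.inl
      d := coprod.inl
      m' := coprod.inl
      k := coprod.map p₁.l (𝟙 _)
      c := coprod.map p₁.r (𝟙 _)
      pushout_left := (IsPushout.of_coprod_inl_with_id p₁.l p₂.L).flip
      pushout_right := (IsPushout.of_coprod_inl_with_id p₁.r p₂.L).flip }
  t₂ :=
    { D := p₁.L ⨿ p₂.I
      H := p₁.L ⨿ p₂.R
      m := coprod.inr
      d := coprod.inr
      m' := coprod.inr
      k := coprod.map (𝟙 _) p₂.l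
      c := coprod.map (𝟙 _) p₂.r
      pushout_left := isPushout_coprod_inr p₂.l p₁.L
      pushout_right := isPushout_coprod_inr p₂.r p₁.L }

/-- The extension AC `ac_K` of the symbolic transformation pair with underlying AC-disregarding
transformation pair `tp`. -/
def extensionAC (E' : PairClass C) (ρ₁ ρ₂ : Rule M)
    (tp : TransformationPair ρ₁.toPlainRule ρ₂.toPlainRule) : AC tp.G :=
  (ρ₁.ac.shift E' M tp.t₁.m).and (ρ₂.ac.shift E' M tp.t₂.m)

open Classical in
/-- The conflict-inducing AC `ac*_K` of the symbolic transformation pair with underlying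
AC-disregarding transformation pair `tp`. -/
noncomputable def conflictInducingAC (E' : PairClass C) (ρ₁ ρ₂ : Rule M)
    (tp : TransformationPair ρ₁.toPlainRule ρ₂.toPlainRule) : AC tp.G :=
  AC.neg (AC.and
    (if h : ∃ d₁₂ : ρ₁.L ⟶ tp.t₂.D, d₁₂ ≫ tp.t₂.k = tp.t₁.m then
      (ρ₁.ac.shift E' M (h.choose ≫ tp.t₂.c)).left tp.t₂.k tp.t₂.c else AC.ff tp.G)
    (if h : ∃ d₂₁ : ρ₂.L ⟶ tp.t₁.D, d₂₁ ≫ tp.t₁.k = tp.t₂.m then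
      (ρ₂.ac.shift E' M (h.choose ≫ tp.t₁.c)).left tp.t₁.k tp.t₁.c else AC.ff tp.G))

/-- A symbolic transformation pair. -/
structure SymbolicTransformationPair (E' : PairClass C) (ρ₁ ρ₂ : Rule M) where
  tp : TransformationPair ρ₁.toPlainRule ρ₂.toPlainRule
  acK : AC tp.G
  acKstar : AC tp.G
  acK_eq : acK = extensionAC E' ρ₁ ρ₂ tp
  acKstar_eq : acKstar = conflictInducingAC E' ρ₁ ρ₂ tp

variable {E' : PairClass C} {ρ₁ ρ₂ : Rule M}

/-- The unfolding: all pairs of direct transformations into which the symbolic transformation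
pair can be embedded. -/
def unfolding (stp : SymbolicTransformationPair E' ρ₁ ρ₂) :
    Set (TransformationPair ρ₁.toPlainRule ρ₂.toPlainRule) :=
  {tp | SatisfiesACs ρ₁ ρ₂ tp ∧ Nonempty (Embedding stp.tp tp)}

def IsConflictInducing (stp : SymbolicTransformationPair E' ρ₁ ρ₂) : Prop :=
  ∃ tp ∈ unfolding stp, IsConflict ρ₁ ρ₂ tp

/-- An initial conflict for rules with application conditions. -/
def IsInitialConflict [HasBinaryCoproducts C] (stp : SymbolicTransformationPair E' ρ₁ ρ₂) :
    Prop :=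
  IsConflictInducing stp ∧
    (IsPlainInitialConflict stp.tp ∨
      Isomorphic stp.tp (coproductPair ρ₁.toPlainRule ρ₂.toPlainRule))

/-! ## Regularity and disjunctive unfolding -/

/-- A positive literal `∃(a : K ⟶ X, ⋀ j, ¬∃(b j : X ⟶ N j, d j))` with negative remainder. -/
structure Literal (K : C) where
  X : C
  a : K ⟶ X
  J : Type (max u v)
  N : J → C
  b : ∀ j, X ⟶ N j
  d : ∀ j, AC (N j)

def Literal.toAC {K : C} (lit : Literal K) : AC K :=
  AC.ex lit.a (AC.conj lit.J fun j => AC.neg (AC.ex (lit.b j) (lit.d j)))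

/-- The given non-empty family of literals witnesses that the initial conflict is regular. -/
def IsRegularDecomposition (stp : SymbolicTransformationPair E' ρ₁ ρ₂) {ι : Type (max u v)}
    (lit : ι → Literal stp.tp.G) : Prop :=
  Nonempty ι ∧ (∀ i j, ¬ IsIso ((lit i).b j)) ∧
    AC.Equivalent M (stp.acK.and stp.acKstar) (AC.disj ι fun i => (lit i).toAC)

/-- The disjunctive unfolding with respect to a family of literals: all pairs of direct
transformations via the rules with matches `a ∘ o₁` and `a ∘ o₂`, `a` the morphism of a literal. -/
def disjunctiveUnfolding (stp : SymbolicTransformationPair E' ρ₁ ρ₂) {ι : Type (max u v)}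
    (lit : ι → Literal stp.tp.G) : Set (TransformationPair ρ₁.toPlainRule ρ₂.toPlainRule) :=
  {tp | SatisfiesACs ρ₁ ρ₂ tp ∧ ∃ (i : ι)
    (t₁ : DirectTransformation ρ₁.toPlainRule (lit i).X)
    (t₂ : DirectTransformation ρ₂.toPlainRule (lit i).X),
    t₁.m = stp.tp.t₁.m ≫ (lit i).a ∧ t₂.m = stp.tp.t₂.m ≫ (lit i).a ∧ tp = ⟨(lit i).X, t₁, t₂⟩}

end Transformations

/-! ## Rules with NACs -/

/-- A family of morphisms out of `P`. -/
structure ArrowFamily {C : Type u} [Category.{v} C] (P : C) where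
  J : Type (max u v)
  N : J → C
  n : ∀ j, P ⟶ N j

namespace ArrowFamily

variable {C : Type u} [Category.{v} C]

/-- The conjunction of NACs `⋀ j, ¬∃ n j`. -/
def nacs {P : C} (F : ArrowFamily P) : AC P :=
  AC.conj F.J fun j => AC.neg (AC.ex (F.n j) (AC.tt (F.N j)))

/-- The literals that arise by shifting the literals `∃ n j` over `b`. -/
def shift (E' : PairClass C) (M : MorphismProperty C) {P P' : C} (F : ArrowFamily P)
    (b : P ⟶ P') : ArrowFamily P' where
  J := Σ j, ShiftSquare E' M b (F.n j)
  N s := s.2.X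
  n s := s.2.a'

/-- The literals that arise by shifting the literals `∃ n j` over the rule
`L ⟵l- I -r⟶ R`. -/
noncomputable def left {L I R : C} (F : ArrowFamily R) (l : I ⟶ L) (r : I ⟶ R) :
    ArrowFamily L where
  J := {j : F.J // Nonempty (DerivedSpan l r (F.n j))}
  N j := j.2.some.Y
  n j := j.2.some.b

/-- The union of two families. -/
def union {P : C} (F F' : ArrowFamily P) : ArrowFamily P where
  J := F.J ⊕ F'.J
  N := Sum.elim F.N F'.N
  n := fun j => match j with
    | Sum.inl j => F.n j
    | Sum.inr j => F'.n j

/-- The `E'`-quotients `e : P ⟶ X` of `P`, i.e. `(e, e)` is in `E'`. -/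
def quotients (E' : PairClass C) (P : C) : ArrowFamily P where
  J := Σ X : C, {e : P ⟶ X // E' e e}
  N s := s.1
  n s := s.2.1

/-- The identity is a quotient. -/
theorem id_mem_quotients {E' : PairClass C} {M : MorphismProperty C} [MAdhesive M]
    (hE : HasPairFactorization E' M) (P : C) : E' (𝟙 P) (𝟙 P) := by
  obtain ⟨K, e₁, e₂, m, he, hm, h₁, h₂⟩ := hE.exists_factorization (𝟙 P) (𝟙 P)
  have : Mono m := MAdhesive.mono _ hm
  have : IsSplitEpi m := ⟨⟨⟨e₁, h₁⟩⟩⟩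
  have : IsIso m := isIso_of_mono_of_isSplitEpi m
  simpa [h₁, h₂] using hE.comp_iso e₁ e₂ m he

end ArrowFamily

section NACs

variable {C : Type u} [Category.{v} C] {M : MorphismProperty C} {E' : PairClass C}
  {ρ₁ ρ₂ : Rule M}

/-- The NACs `¬∃ n` whose conjunction is the extension AC, when the rules carry the NACs `F₁`
and `F₂`. -/
def extensionNACs (stp : SymbolicTransformationPair E' ρ₁ ρ₂) (F₁ : ArrowFamily ρ₁.L)
    (F₂ : ArrowFamily ρ₂.L) : ArrowFamily stp.tp.G :=
  (F₁.shift E' M stp.tp.t₁.m).union (F₂.shift E' M stp.tp.t₂.m)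

open Classical in
/-- The PACs `∃ a` whose disjunction is the conflict-inducing AC, when the rules carry the NACs
`F₁` and `F₂`. If the plain pair is dependent, the conflict-inducing AC is `true`; a morphism out
of `K` satisfies `∃ id_K` only if it is in `M`, and `true` is the disjunction of all `∃ e` with `e`
an `E'`-quotient of `K` (one of which is `id_K`). -/
noncomputable def conflictPACs (stp : SymbolicTransformationPair E' ρ₁ ρ₂)
    (F₁ : ArrowFamily ρ₁.L) (F₂ : ArrowFamily ρ₂.L) : ArrowFamily stp.tp.G :=
  if h : (∃ d₁₂ : ρ₁.L ⟶ stp.tp.t₂.D, d₁₂ ≫ stp.tp.t₂.k = stp.tp.t₁.m) ∧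
      (∃ d₂₁ : ρ₂.L ⟶ stp.tp.t₁.D, d₂₁ ≫ stp.tp.t₁.k = stp.tp.t₂.m) then
    ((F₁.shift E' M (h.1.choose ≫ stp.tp.t₂.c)).left stp.tp.t₂.k stp.tp.t₂.c).union
      ((F₂.shift E' M (h.2.choose ≫ stp.tp.t₁.c)).left stp.tp.t₁.k stp.tp.t₁.c)
  else ArrowFamily.quotients E' stp.tp.G

/-- The NACs obtained by shifting the NACs of the extension AC over the `i`-th PAC of the
conflict-inducing AC. -/
noncomputable def remainder (stp : SymbolicTransformationPair E' ρ₁ ρ₂) (F₁ : ArrowFamily ρ₁.L)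
    (F₂ : ArrowFamily ρ₂.L) (i : (conflictPACs stp F₁ F₂).J) :
    ArrowFamily ((conflictPACs stp F₁ F₂).N i) :=
  (extensionNACs stp F₁ F₂).shift E' M ((conflictPACs stp F₁ F₂).n i)

/-- PACs with an isomorphism among their remainder NACs give unsatisfiable literals and are
dropped. -/
def NACLiteralIndex (stp : SymbolicTransformationPair E' ρ₁ ρ₂) (F₁ : ArrowFamily ρ₁.L)
    (F₂ : ArrowFamily ρ₂.L) : Type (max u v) :=
  {i : (conflictPACs stp F₁ F₂).J // ∀ q, ¬ IsIso ((remainder stp F₁ F₂ i).n q)}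

/-- The literals chosen for an initial conflict of rules with NACs. -/
noncomputable def nacLiterals (stp : SymbolicTransformationPair E' ρ₁ ρ₂) (F₁ : ArrowFamily ρ₁.L)
    (F₂ : ArrowFamily ρ₂.L) (i : NACLiteralIndex stp F₁ F₂) : Literal stp.tp.G where
  X := (conflictPACs stp F₁ F₂).N i.1
  a := (conflictPACs stp F₁ F₂).n i.1
  J := (remainder stp F₁ F₂ i.1).J
  N := (remainder stp F₁ F₂ i.1).N
  b := (remainder stp F₁ F₂ i.1).n
  d := fun _ => AC.tt _

/-- Critical pairs for rules `ρ₁`, `ρ₂` whose application conditions are the NACs `F₁`, `F₂`. -/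
def IsNACCriticalPair (E' : PairClass C) (F₁ : ArrowFamily ρ₁.L) (F₂ : ArrowFamily ρ₂.L)
    (tp : TransformationPair ρ₁.toPlainRule ρ₂.toPlainRule) : Prop :=
  (F₁.nacs.Sat M tp.t₁.m ∧ F₂.nacs.Sat M tp.t₂.m) ∧
  (
    -- use-delete conflict
    ((¬ ∃ h₁₂ : ρ₁.L ⟶ tp.t₂.D, h₁₂ ≫ tp.t₂.k = tp.t₁.m) ∧ E' tp.t₁.m tp.t₂.m) ∨
    -- forbid-produce conflict
    (∃ h₁₂ : ρ₁.L ⟶ tp.t₂.D, h₁₂ ≫ tp.t₂.k = tp.t₁.m ∧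
      ∃ (j : F₁.J) (q₁₂ : F₁.N j ⟶ tp.t₂.H), M q₁₂ ∧ F₁.n j ≫ q₁₂ = h₁₂ ≫ tp.t₂.c ∧
        E' q₁₂ tp.t₂.m') ∨
    -- delete-use conflict
    ((¬ ∃ h₂₁ : ρ₂.L ⟶ tp.t₁.D, h₂₁ ≫ tp.t₁.k = tp.t₂.m) ∧ E' tp.t₁.m tp.t₂.m) ∨
    -- produce-forbid conflict
    (∃ h₂₁ : ρ₂.L ⟶ tp.t₁.D, h₂₁ ≫ tp.t₁.k = tp.t₂.m ∧
      ∃ (j : F₂.J) (q₂₁ : F₂.N j ⟶ tp.t₁.H), M q₂₁ ∧ F₂.n j ≫ q₂₁ = h₂₁ ≫ tp.t₁.c ∧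
        E' q₂₁ tp.t₁.m'))

end NACs

end InitialConflicts

open InitialConflicts

/-! Regularity is a matter of logic. By `AC.sat_shift` and `AC.sat_left`, shifting over a morphism
amounts to precomposition, and shifting over a rule trades the comatch for the match. If the plain
pair is independent, De Morgan turns the conflict-inducing condition into a disjunction of PACs. If
it is dependent, that condition is true, and true is the disjunction of all `∃ e` with `e` an
`E'`-quotient, because every morphism is such a quotient followed by an `M`-morphism. Shifting the
NACs over a PAC moves them into the scope of its existential. The dropped literals are
unsatisfiable. Some literal survives because the extension morphism into a conflict satisfies both
conditions.

For the critical pairs, `E'` is characterised by extremality (`mem_E'_iff`): a pair is in `E'` iff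
it factors through no proper `M`-subobject. Every transformation restricts to an `M`-subobject
containing its match, so initiality makes the matches of a plain initial conflict extremal
(`isIso_of_isInitialFor`). An `E'`-quotient keeps them extremal (`comp_mem_E'_of_quotient`), and
dependence survives any extension (`exists_factor_of_isPushout`). This gives the use-delete cases.

In the independent case the pair is the coproduct pair, so the object after the second
transformation is `L₁ + R₂`. A subobject containing the forbidden pattern `N` already contains the
image of `L₁`; if it also contains the image of `R₂`, it contains that of the whole sum. Extremality
of the shifted pair thus yields extremality of pattern and comatch
(`exists_forbidden_of_derivedSpan`), which gives the forbid-produce cases. Being a conflict then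
follows from being a critical pair. -/

namespace InitialConflicts

variable {C : Type u} [Category.{v} C]

/-! ## Pushouts along `M`-morphisms -/

section Adhesive

variable (M : MorphismProperty C) [MAdhesive M]

instance : M.IsMultiplicative := MAdhesive.isMultiplicative
instance : M.HasOfPostcompProperty M := MAdhesive.decomposition
instance : M.IsStableUnderCobaseChange := MAdhesive.stableUnderPushout
instance : M.IsStableUnderBaseChange := MAdhesive.stableUnderPullback

variable {M}

theorem mono_of_mem {X Y : C} {f : X ⟶ Y} (hf : M f) : Mono f := MAdhesive.mono _ hf

variable {I L D G : C} {l : I ⟶ L} {d : I ⟶ D} {m : L ⟶ G} {k : D ⟶ G}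

theorem mem_of_isPushout (sq : IsPushout l d m k) (hl : M l) : M k :=
  M.of_isPushout sq.flip hl

/-- Pushouts along `M`-morphisms are pullbacks. -/
theorem isPullback_of_isPushout (sq : IsPushout l d m k) (hl : M l) : IsPullback l d m k := by
  have := mono_of_mem hl
  -- The cube has the trivial pushout of `𝟙 I` and `d` on top; one of its front faces is the given
  -- square.
  have h := (MAdhesive.vanKampen sq hl (𝟙 I) d d (𝟙 D) (𝟙 I) l (𝟙 D) k hl (M.id_mem D)
    (mem_of_isPushout sq hl) (IsPullback.of_horiz_isIso_mono ⟨by simp⟩)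
    (IsPullback.of_vert_isIso_mono ⟨by simp⟩) ⟨sq.w.symm⟩ ⟨by simp⟩ ⟨by simp⟩).1
    (IsPushout.of_horiz_isIso ⟨by simp⟩)
  exact h.1.flip

/-- The pullback of a pushout along an `M`-morphism over an `M`-subobject is a pushout. -/
theorem isPushout_restrict (sq : IsPushout l d m k) (hl : M l) {I' L' D' S : C} {s : S ⟶ G}
    (hs : M s) {l' : I' ⟶ L'} {d' : I' ⟶ D'} {m' : L' ⟶ S} {k' : D' ⟶ S} {w : I' ⟶ I}
    {x : L' ⟶ L} {t : D' ⟶ D} (pL : IsPullback m' x s m) (pD : IsPullback k' t s k)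
    (pI : IsPullback l' w x l) (h : d' ≫ t = w ≫ d) (h' : l' ≫ m' = d' ≫ k') :
    IsPushout l' d' m' k' := by
  have pI' : IsPullback d' w t d := by
    refine IsPullback.of_right ?_ h pD
    rw [← h', ← sq.w]
    exact pI.paste_horiz pL
  exact (MAdhesive.vanKampen sq hl l' d' m' k' w x t s (M.of_isPullback pL hs)
    (M.of_isPullback pD hs) hs pI pI' ⟨pL.w⟩ ⟨pD.w⟩ ⟨h'⟩).2 ⟨pL, pD⟩

/-- Pushout-pullback decomposition along an `M`-subobject through which the match factors. -/
theorem exists_isPushout_restrict (sq : IsPushout l d m k) (hl : M l) {S : C} {s : S ⟶ G}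
    (hs : M s) {m₀ : L ⟶ S} (hm : m₀ ≫ s = m) :
    ∃ (Z : C) (z : I ⟶ Z) (k' : Z ⟶ S) (t : Z ⟶ D), M t ∧ z ≫ t = d ∧ IsPushout l z m₀ k' ∧
      IsPushout k' t s k := by
  have := MAdhesive.hasPullback s k hs
  have := mono_of_mem hs
  have pD : IsPullback (pullback.fst s k) (pullback.snd s k) s k := IsPullback.of_hasPullback s k
  have hw : (l ≫ m₀) ≫ s = d ≫ k := by rw [Category.assoc, hm, sq.w]
  have hz : pD.lift (l ≫ m₀) d hw ≫ pullback.snd s k = d := pD.lift_snd _ _ _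
  -- As `s` is mono and `m` factors through it, restricting to `S` leaves `I` and `L` unchanged;
  -- only `D` shrinks.
  have po : IsPushout l (pD.lift (l ≫ m₀) d hw) m₀ (pullback.fst s k) :=
    isPushout_restrict sq hl hs (w := 𝟙 I) (x := 𝟙 L)
      (IsPullback.of_vert_isIso_mono ⟨by simpa using hm⟩) pD
      (IsPullback.of_vert_isIso ⟨by simp⟩) (by simp) (by simp)
  refine ⟨_, _, _, _, M.of_isPullback pD hs, hz, po, IsPushout.of_top ?_ pD.w po⟩
  rw [hz, hm]
  exact sq

/-- Whatever is preserved by a transformation at a match `m ≫ a` is preserved by a transformation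
at the match `m`. -/
theorem exists_factor_of_isPushout (sq : IsPushout l d m k) (hl : M l) {X D' : C} {a : G ⟶ X}
    {d' : I ⟶ D'} {k' : D' ⟶ X} (sq' : IsPushout l d' (m ≫ a) k') {T : C} (x : T ⟶ G)
    (h : T ⟶ D') (hx : h ≫ k' = x ≫ a) : ∃ y : T ⟶ D, y ≫ k = x := by
  have hk' := mem_of_isPushout sq' hl
  have := mono_of_mem hl
  have := MAdhesive.hasPullback k' a hk'
  have pS : IsPullback (pullback.snd k' a) (pullback.fst k' a) a k' :=
    (IsPullback.of_hasPullback k' a).flip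
  have hs : M (pullback.snd k' a) := M.of_isPullback pS.flip hk'
  have := mono_of_mem hs
  generalize pullback.snd k' a = s, pullback.fst k' a = e at pS hs
  have := MAdhesive.hasPullback s k hs
  have pD : IsPullback (pullback.fst s k) (pullback.snd s k) s k := IsPullback.of_hasPullback s k
  have pL' : IsPullback l d' (m ≫ a) k' := isPullback_of_isPushout sq' hl
  have hi : (l ≫ m) ≫ a = d' ≫ k' := by rw [Category.assoc, sq'.w]
  have hi₁ : pS.lift (l ≫ m) d' hi ≫ s = l ≫ m := pS.lift_fst _ _ _
  have hi₂ : pS.lift (l ≫ m) d' hi ≫ e = d' := pS.lift_snd _ _ _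
  have pL : IsPullback (pS.lift (l ≫ m) d' hi) l s m := by
    refine IsPullback.of_right ?_ hi₁ pS.flip
    rw [hi₂]
    exact pL'.flip
  have hw : pS.lift (l ≫ m) d' hi ≫ s = d ≫ k := by rw [hi₁, sq.w]
  -- The subobject `S`, the preimage of `D'` under `a`, meets `L` exactly in `I`. Restricting the
  -- pushout to `S` therefore gives a pushout along `𝟙 I`, so `S` lies inside `D`; and `x` lands in
  -- `S`.
  have po : IsPushout (𝟙 I) (pD.lift _ d hw) (pS.lift (l ≫ m) d' hi) (pullback.fst s k) :=
    isPushout_restrict sq hl hs (w := 𝟙 I) pL pD (IsPullback.of_horiz_isIso_mono ⟨by simp⟩)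
      (by simp) (by simp)
  have := po.isIso_inr_of_isIso
  refine ⟨pS.lift x h hx.symm ≫ inv (pullback.fst s k) ≫ pullback.snd s k, ?_⟩
  rw [Category.assoc, Category.assoc, ← pD.w, IsIso.inv_hom_id_assoc, pS.lift_fst]

/-- Uniqueness of pushout complements: `exists_factor_of_isPushout` with `a = 𝟙 G` shows that each
is contained in the other as a subobject of `G`. -/
theorem exists_iso_of_isPushout (sq : IsPushout l d m k) (hl : M l) {D' : C} {d' : I ⟶ D'}
    {k' : D' ⟶ G} (sq' : IsPushout l d' m k') :
    ∃ φ : D ≅ D', d ≫ φ.hom = d' ∧ φ.hom ≫ k' = k := by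
  have := mono_of_mem (mem_of_isPushout sq hl)
  have := mono_of_mem (mem_of_isPushout sq' hl)
  obtain ⟨y, hy⟩ := exists_factor_of_isPushout (a := 𝟙 G) sq hl (by simpa using sq') k' (𝟙 D')
    (by simp)
  obtain ⟨y', hy'⟩ := exists_factor_of_isPushout (a := 𝟙 G) sq' hl (by simpa using sq) k (𝟙 D)
    (by simp)
  refine ⟨⟨y', y, ?_, ?_⟩, ?_, hy'⟩
  · rw [← cancel_mono k, Category.assoc, hy, hy', Category.id_comp]
  · rw [← cancel_mono k', Category.assoc, hy', hy, Category.id_comp]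
  · rw [← cancel_mono k', Category.assoc, hy', ← sq.w, sq'.w]

/-- Pushout complements extend along `M`-morphisms. -/
theorem exists_isPushout_extend (sq : IsPushout l d m k) (hl : M l) {Z Y : C} {z : I ⟶ Z}
    {b : L ⟶ Y} {l' : Z ⟶ Y} (sq' : IsPushout l z b l') {q : Y ⟶ G} (hq : M q) (hb : b ≫ q = m) :
    ∃ t : Z ⟶ D, M t ∧ z ≫ t = d ∧ IsPushout l' t q k := by
  obtain ⟨Z', z', k', t, ht, hzt, po, po'⟩ := exists_isPushout_restrict sq hl hq hb
  obtain ⟨φ, hφ, hφ'⟩ := exists_iso_of_isPushout sq' hl po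
  have hφt : z ≫ φ.hom ≫ t = d := by rw [← Category.assoc, hφ, hzt]
  refine ⟨φ.hom ≫ t, (M.cancel_left_of_respectsIso _ _).2 ht, hφt, ?_⟩
  refine IsPushout.of_top ?_ ?_ sq'
  · rw [hφt, hb]
    exact sq
  · rw [← hφ', Category.assoc, po'.w, Category.assoc]

end Adhesive

end InitialConflicts

namespace InitialConflicts

variable {C : Type u} [Category.{v} C] {M : MorphismProperty C} {E' : PairClass C}

/-! ## Satisfaction of shifted conditions -/

namespace AC

theorem sat_ex {P Q G : C} (a : P ⟶ Q) (c : AC Q) (p : P ⟶ G) :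
    (ex a c).Sat M p ↔ ∃ q : Q ⟶ G, M q ∧ a ≫ q = p ∧ c.Sat M q := Iff.rfl

theorem sat_neg {P G : C} (c : AC P) (p : P ⟶ G) : (neg c).Sat M p ↔ ¬ c.Sat M p := Iff.rfl

theorem sat_conj {P G : C} (ι : Type (max u v)) (c : ι → AC P) (p : P ⟶ G) :
    (conj ι c).Sat M p ↔ ∀ i, (c i).Sat M p := Iff.rfl

theorem sat_tt {P G : C} (p : P ⟶ G) : (tt P).Sat M p := fun i => i.elim

theorem not_sat_ff {P G : C} (p : P ⟶ G) : ¬ (ff P).Sat M p := fun h => h (sat_tt p)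

theorem sat_disj {P G : C} (ι : Type (max u v)) (c : ι → AC P) (p : P ⟶ G) :
    (disj ι c).Sat M p ↔ ∃ i, (c i).Sat M p := by
  simp [disj, sat_neg, sat_conj]

theorem sat_and {P G : C} (c₁ c₂ : AC P) (p : P ⟶ G) :
    (c₁.and c₂).Sat M p ↔ c₁.Sat M p ∧ c₂.Sat M p := by
  simp [AC.and, sat_conj, and_comm]

variable [MAdhesive M]

/-- In the existential case, the pair factorization of `p` and a witness `q` supplies the disjunct;
its `b'` is in `M` by decomposition. -/
theorem sat_shift (hE : HasPairFactorization E' M) {P : C} (c : AC P) {P' : C} (b : P ⟶ P')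
    {G : C} (p : P' ⟶ G) : (c.shift E' M b).Sat M p ↔ c.Sat M (b ≫ p) := by
  induction c generalizing P' G with
  | ex a c ih =>
    simp only [shift, sat_disj, sat_ex, ih]
    constructor
    · rintro ⟨s, q, hq, rfl, h⟩
      exact ⟨s.b' ≫ q, M.comp_mem _ _ s.mem_M hq, by rw [← Category.assoc, s.comm, Category.assoc],
        h⟩
    · rintro ⟨q, hq, h, hc⟩
      obtain ⟨X, e₁, e₂, m, he, hm, rfl, rfl⟩ := hE.exists_factorization p q
      have := mono_of_mem hm
      refine ⟨⟨X, e₁, e₂, he, M.of_postcomp _ _ hm hq, ?_⟩, m, hm, rfl, hc⟩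
      rw [← cancel_mono m, Category.assoc, h, Category.assoc]
  | neg c ih => simp only [shift, sat_neg, ih]
  | conj ι c ih => simp only [shift, sat_conj, ih]

/-- Extending the pushout complement along a witness on one side and pushing out on the other side
produces the matching witness. The resulting squares form a double pushout for the derived rule, to
which the induction hypothesis applies. -/
theorem sat_left {R : C} (c : AC R) {L I : C} {l : I ⟶ L} {r : I ⟶ R} (hl : M l) (hr : M r)
    {G D H : C} {d : I ⟶ D} {m : L ⟶ G} {k : D ⟶ G} {m' : R ⟶ H} {g : D ⟶ H}
    (sq : IsPushout l d m k) (sq' : IsPushout r d m' g) :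
    (c.left l r).Sat M m ↔ c.Sat M m' := by
  induction c generalizing L I G D H with
  | ex a c ih =>
    simp only [left]
    split_ifs with hs
    -- Only the two pushouts of the chosen derived span matter, not the choice.
    · generalize hs.some = s
      simp only [sat_ex]
      constructor
      · rintro ⟨q, hq, hb, hc⟩
        obtain ⟨t, ht, hz, po⟩ := exists_isPushout_extend sq hl s.left hq hb
        subst hz
        have po' := IsPushout.of_top' sq' s.right
        exact ⟨_, M.of_isPushout po' ht, s.right.inl_desc _ _ _,
          (ih (mem_of_isPushout s.left hl) (mem_of_isPushout s.right hr) po po').1 hc⟩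
      · rintro ⟨q, hq, hb, hc⟩
        obtain ⟨t, ht, hz, po⟩ := exists_isPushout_extend sq' hr s.right hq hb
        subst hz
        have po' := IsPushout.of_top' sq s.left
        exact ⟨_, M.of_isPushout po' ht, s.left.inl_desc _ _ _,
          (ih (mem_of_isPushout s.left hl) (mem_of_isPushout s.right hr) po' po).2 hc⟩
    · refine iff_of_false (not_sat_ff _) ?_
      -- A witness in `M` would itself create the missing pushout complement, by restriction to its
      -- domain.
      rintro ⟨q, hq, hb, -⟩
      obtain ⟨Z, z, k', t, -, -, po, -⟩ := exists_isPushout_restrict sq' hr hq hb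
      have := MAdhesive.hasPushout l z hl
      exact hs ⟨⟨Z, _, z, _, _, k', po, IsPushout.of_hasPushout l z⟩⟩
  | neg c ih => simp only [left, sat_neg, ih hl hr sq sq']
  | conj ι c ih => simp only [left, sat_conj, fun i => ih i hl hr sq sq']

end AC

/-! ## Families of arrows -/

namespace ArrowFamily

theorem sat_nacs {P G : C} (F : ArrowFamily P) (p : P ⟶ G) :
    F.nacs.Sat M p ↔ ∀ j, ¬ ∃ q : F.N j ⟶ G, M q ∧ F.n j ≫ q = p := by
  simp only [nacs, AC.sat_conj, AC.sat_neg, AC.sat_ex]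
  exact forall_congr' fun j => not_congr
    ⟨fun ⟨q, hq, h, _⟩ => ⟨q, hq, h⟩, fun ⟨q, hq, h⟩ => ⟨q, hq, h, AC.sat_tt q⟩⟩

theorem not_sat_nacs_of_isIso [MAdhesive M] {P G : C} (F : ArrowFamily P) (j : F.J)
    (hj : IsIso (F.n j)) {q : P ⟶ G} (hq : M q) : ¬ F.nacs.Sat M q := fun h =>
  (F.sat_nacs q).1 h j ⟨inv (F.n j) ≫ q, (M.cancel_left_of_respectsIso _ _).2 hq,
    IsIso.hom_inv_id_assoc _ _⟩

theorem sat_nacs_union {P G : C} (F F' : ArrowFamily P) (p : P ⟶ G) :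
    (F.union F').nacs.Sat M p ↔ F.nacs.Sat M p ∧ F'.nacs.Sat M p := by
  simp only [sat_nacs]
  exact Sum.forall

theorem sat_shift_nacs {P P' G : C} (F : ArrowFamily P) (b : P ⟶ P') (p : P' ⟶ G) :
    (F.nacs.shift E' M b).Sat M p ↔ (F.shift E' M b).nacs.Sat M p := by
  simp only [sat_nacs]
  simp only [nacs, AC.shift, AC.sat_conj, AC.sat_neg, AC.sat_disj, AC.sat_ex, not_exists]
  constructor
  · rintro h ⟨j, s⟩ q ⟨hq, hp⟩
    exact h j s q ⟨hq, hp, fun i => i.elim⟩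
  · rintro h j s q ⟨hq, hp, -⟩
    exact h ⟨j, s⟩ q ⟨hq, hp⟩

/-- A disjunct without pushout complement becomes false, so its negation imposes nothing; this is
why `ArrowFamily.left` keeps only the other indices. -/
theorem sat_left_shift_nacs {P R L I G : C} (F : ArrowFamily P) (b : P ⟶ R) (l : I ⟶ L)
    (r : I ⟶ R) (p : L ⟶ G) :
    ((F.nacs.shift E' M b).left l r).Sat M p ↔ ((F.shift E' M b).left l r).nacs.Sat M p := by
  simp only [sat_nacs]
  simp only [nacs, AC.shift, AC.disj, AC.left, AC.sat_conj, AC.sat_neg, not_not, not_exists]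
  constructor
  · rintro h ⟨⟨j, s⟩, hs⟩ q ⟨hq, hp⟩
    have h' := h j s
    rw [dif_pos (show Nonempty (DerivedSpan l r s.a') from hs)] at h'
    exact h' ⟨q, hq, hp, fun i => i.elim⟩
  · intro h j s
    split_ifs with hs
    · rintro ⟨q, hq, hp, -⟩
      exact h ⟨⟨j, s⟩, hs⟩ q ⟨hq, hp⟩
    · exact AC.not_sat_ff p

end ArrowFamily

/-! ## Jointly extremal pairs -/

section Extremal

variable [MAdhesive M]

/-- The pairs in `E'` are those that do not factor through a proper `M`-subobject. -/
theorem mem_E'_iff (hE : HasPairFactorization E' M) {A B X : C} (f : A ⟶ X) (g : B ⟶ X) :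
    E' f g ↔ ∀ ⦃S : C⦄ (m : S ⟶ X) (f' : A ⟶ S) (g' : B ⟶ S), M m → f' ≫ m = f → g' ≫ m = g →
      IsIso m := by
  constructor
  · rintro h S m f' g' hm rfl rfl
    obtain ⟨T, e₁, e₂, n, he, hn, rfl, rfl⟩ := hE.exists_factorization f' g'
    obtain ⟨i, -, -, hi⟩ := hE.unique_factorization e₁ e₂ (n ≫ m) _ _ (𝟙 X) he
      (M.comp_mem _ _ hn hm) h (M.id_mem X) (by simp) (by simp)
    have := mono_of_mem hm
    have : IsSplitEpi m := ⟨⟨⟨i.inv ≫ n, by rw [Category.assoc, ← hi]; simp⟩⟩⟩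
    exact isIso_of_mono_of_isSplitEpi m
  · intro h
    obtain ⟨T, e₁, e₂, n, he, hn, rfl, rfl⟩ := hE.exists_factorization f g
    have := h n e₁ e₂ hn rfl rfl
    exact hE.comp_iso e₁ e₂ n he

/-- Every morphism factors as an `E'`-quotient followed by an `M`-morphism. -/
theorem exists_quotient_factorization (hE : HasPairFactorization E' M) {P G : C} (p : P ⟶ G) :
    ∃ (X : C) (e : P ⟶ X) (m : X ⟶ G), E' e e ∧ M m ∧ e ≫ m = p := by
  obtain ⟨X, e₁, e₂, m, he, hm, h₁, h₂⟩ := hE.exists_factorization p p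
  have := mono_of_mem hm
  obtain rfl : e₁ = e₂ := by rw [← cancel_mono m, h₁, h₂]
  exact ⟨X, e₁, m, he, hm, h₁⟩

/-- An `M`-subobject of `X` containing both composites pulls back along `a` to one containing `f`
and `g`, hence to an isomorphism. So `a` factors through the subobject, which is then everything. -/
theorem comp_mem_E'_of_quotient (hE : HasPairFactorization E' M) {A B K X : C} {f : A ⟶ K}
    {g : B ⟶ K} {a : K ⟶ X} (h : E' f g)
    (ha : E' a a) : E' (f ≫ a) (g ≫ a) := by
  rw [mem_E'_iff hE] at h ha ⊢
  intro S m f' g' hm hf hg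
  have := MAdhesive.hasPullback m a hm
  have pb := IsPullback.of_hasPullback m a
  have := h (pullback.snd m a) (pb.lift f' f hf) (pb.lift g' g hg) (M.of_isPullback pb hm)
    (pb.lift_snd _ _ _) (pb.lift_snd _ _ _)
  have hq : (inv (pullback.snd m a) ≫ pullback.fst m a) ≫ m = a := by
    rw [Category.assoc, pb.w, IsIso.inv_hom_id_assoc]
  exact ha m _ _ hm hq hq

end Extremal

/-! ## Embeddings of transformation pairs -/

section Transformations

theorem ExtensionDiagram.nonempty_comp {p : PlainRule M} {G G' G'' : C}
    {t : DirectTransformation p G} {t' : DirectTransformation p G'}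
    {t'' : DirectTransformation p G''} {f : G ⟶ G'} {f' : G' ⟶ G''} (e : ExtensionDiagram t t' f)
    (e' : ExtensionDiagram t' t'' f') : Nonempty (ExtensionDiagram t t'' (f ≫ f')) :=
  ⟨{ fD := e.fD ≫ e'.fD
     fH := e.fH ≫ e'.fH
     comm_m := by rw [← Category.assoc, e.comm_m, e'.comm_m]
     comm_d := by rw [← Category.assoc, e.comm_d, e'.comm_d]
     comm_m' := by rw [← Category.assoc, e.comm_m', e'.comm_m']
     pushout_left := e.pushout_left.paste_vert e'.pushout_left
     pushout_right := e.pushout_right.paste_vert e'.pushout_right }⟩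

theorem ExtensionDiagram.nonempty_id {p : PlainRule M} {G : C} (t : DirectTransformation p G) :
    Nonempty (ExtensionDiagram t t (𝟙 G)) :=
  ⟨{ fD := 𝟙 _
     fH := 𝟙 _
     comm_m := Category.comp_id _
     comm_d := Category.comp_id _
     comm_m' := Category.comp_id _
     pushout_left := IsPushout.of_id_snd
     pushout_right := IsPushout.of_id_snd }⟩

variable {p₁ p₂ : PlainRule M}

theorem Embedding.exists_comp {tp tp' tp'' : TransformationPair p₁ p₂} (e : Embedding tp tp')
    (e' : Embedding tp' tp'') : ∃ e'' : Embedding tp tp'', e''.f = e.f ≫ e'.f :=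
  ⟨⟨_, (e.e₁.nonempty_comp e'.e₁).some, (e.e₂.nonempty_comp e'.e₂).some⟩, rfl⟩

theorem Embedding.exists_id (tp : TransformationPair p₁ p₂) :
    ∃ e : Embedding tp tp, e.f = 𝟙 tp.G :=
  ⟨⟨_, (ExtensionDiagram.nonempty_id tp.t₁).some, (ExtensionDiagram.nonempty_id tp.t₂).some⟩, rfl⟩

variable [MAdhesive M]

theorem DirectTransformation.mem_k {p : PlainRule M} {G : C} (t : DirectTransformation p G) :
    M t.k := mem_of_isPushout t.pushout_left p.mem_l

theorem DirectTransformation.mem_c {p : PlainRule M} {G : C} (t : DirectTransformation p G) :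
    M t.c := mem_of_isPushout t.pushout_right p.mem_r

/-- A direct transformation restricts to any `M`-subobject containing the match. -/
theorem DirectTransformation.exists_restrict {p : PlainRule M} {G S : C}
    (t : DirectTransformation p G) {s : S ⟶ G} (hs : M s) (m₀ : p.L ⟶ S) (h : m₀ ≫ s = t.m) :
    ∃ t₀ : DirectTransformation p S, Nonempty (ExtensionDiagram t₀ t s) := by
  obtain ⟨Z, z, k, f, -, hzf, po, po'⟩ := exists_isPushout_restrict t.pushout_left p.mem_l hs h
  have := MAdhesive.hasPushout p.r z p.mem_r
  have poR := IsPushout.of_hasPushout p.r z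
  have hR : IsPushout p.r (z ≫ f) t.m' t.c := by rw [hzf]; exact t.pushout_right
  exact ⟨⟨Z, _, m₀, z, _, k, _, po, poR⟩, ⟨
    { fD := f
      fH := _
      comm_m := h
      comm_d := hzf
      comm_m' := poR.inl_desc _ _ _
      pushout_left := po'
      pushout_right := IsPushout.of_top' hR poR }⟩⟩

/-- The matches of a plain initial conflict cover its source. -/
theorem isIso_of_isInitialFor {tp tpI : TransformationPair p₁ p₂} (h : IsInitialFor tpI tp)
    (hiso : Isomorphic tp tpI) {S : C} {s : S ⟶ tp.G} (hs : M s) (m₁ : p₁.L ⟶ S) (m₂ : p₂.L ⟶ S)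
    (h₁ : m₁ ≫ s = tp.t₁.m) (h₂ : m₂ ≫ s = tp.t₂.m) : IsIso s := by
  have := mono_of_mem hs
  obtain ⟨eI, hI⟩ := h
  obtain ⟨φ, hφ, -⟩ := hiso
  obtain ⟨t₁, ⟨x₁⟩⟩ := tp.t₁.exists_restrict hs m₁ h₁
  obtain ⟨t₂, ⟨x₂⟩⟩ := tp.t₂.exists_restrict hs m₂ h₂
  obtain ⟨e', he', -⟩ := hI ⟨S, t₁, t₂⟩ ⟨s, x₁, x₂⟩
  -- The isomorphism `φ` need not be inverse to `eI`. Initiality is applied to the embedding `eI`,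
  -- `φ`, `eI` to get a correction `g`; uniqueness then makes `g`, `eI`, `φ` compose to the
  -- identity.
  obtain ⟨e₁, he₁⟩ := eI.exists_comp φ
  obtain ⟨e₂, he₂⟩ := e₁.exists_comp eI
  obtain ⟨g, hg, -⟩ := hI tpI e₂
  obtain ⟨e₃, he₃⟩ := g.exists_comp e₁
  obtain ⟨e₄, he₄⟩ := Embedding.exists_id tpI
  have key : e₃ = e₄ := (hI tpI eI).unique
    (by simpa [he₃, he₁, he₂] using hg) (by simp [he₄])
  have key' : g.f ≫ eI.f ≫ φ.f = 𝟙 _ := by rw [← he₁, ← he₃, key, he₄]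
  have : IsSplitEpi s := ⟨⟨⟨φ.f ≫ g.f ≫ e'.f, by
    rw [← cancel_mono φ.f]
    simp only [Category.assoc] at he' ⊢
    rw [reassoc_of% he', key']
    simp⟩⟩⟩
  exact isIso_of_mono_of_isSplitEpi s

end Transformations

/-! ### Pairs isomorphic to the coproduct pair -/

section Coproducts

variable {p₁ p₂ : PlainRule M}

/-- A transformation of a sum `L + p.L` that leaves the first summand untouched. -/
def DirectTransformation.IsSumWith {p : PlainRule M} {G L : C} (t : DirectTransformation p G)
    (n : L ⟶ G) : Prop :=
  ∃ x : L ⟶ t.D, x ≫ t.k = n ∧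
    (∀ ⦃S : C⦄ (f : L ⟶ S) (g : p.R ⟶ S), ∃ y : t.H ⟶ S, x ≫ t.c ≫ y = f ∧ t.m' ≫ y = g) ∧
    ∀ ⦃S : C⦄ (y y' : t.H ⟶ S), x ≫ t.c ≫ y = x ≫ t.c ≫ y' → t.m' ≫ y = t.m' ≫ y' → y = y'

/-- Up to the isomorphism `e.fH`, the object `t.H` is a sum of `L` and `p.R`, so a morphism out of
it factors through `s` as soon as its two components do. No monicity of `s` is needed. -/
theorem DirectTransformation.IsSumWith.exists_factor [MAdhesive M] {p : PlainRule M} {G G' L : C}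
    {t : DirectTransformation p G} {t' : DirectTransformation p G'} {n' : L ⟶ G'}
    (ht' : t'.IsSumWith n') {f : G ⟶ G'} (e : ExtensionDiagram t t' f) [IsIso e.fH] {d : L ⟶ t.D}
    (hd : d ≫ t.k ≫ f = n') {S X : C} {s : S ⟶ X} {a : t.H ⟶ X} {u : L ⟶ S} {w : p.R ⟶ S}
    (hu : u ≫ s = d ≫ t.c ≫ a) (hw : w ≫ s = t.m' ≫ a) : ∃ y : t.H ⟶ S, y ≫ s = a := by
  obtain ⟨x, hx, hdesc, hext⟩ := ht'
  have := mono_of_mem t'.mem_k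
  obtain rfl : d ≫ e.fD = x := by
    rw [← cancel_mono t'.k, Category.assoc, ← e.pushout_left.w, hd, hx]
  obtain ⟨y, hy₁, hy₂⟩ := hdesc u w
  refine ⟨e.fH ≫ y, ?_⟩
  have key : y ≫ s = inv e.fH ≫ a := by
    apply hext
    · rw [← Category.assoc, ← Category.assoc, Category.assoc (d ≫ e.fD), hy₁, hu,
        Category.assoc d, ← e.pushout_right.w_assoc, IsIso.hom_inv_id_assoc]
    · rw [← Category.assoc, hy₂, hw, ← e.comm_m', Category.assoc, IsIso.hom_inv_id_assoc]
  rw [Category.assoc, key, IsIso.hom_inv_id_assoc]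

theorem DirectTransformation.IsSumWith.exists_preserved {p : PlainRule M} {G G' L : C}
    {t : DirectTransformation p G} {t' : DirectTransformation p G'} {n : L ⟶ G} {n' : L ⟶ G'}
    (ht' : t'.IsSumWith n') {f : G ⟶ G'} [IsIso f] (e : ExtensionDiagram t t' f) [IsIso e.fD]
    (hn : n ≫ f = n') : ∃ d : L ⟶ t.D, d ≫ t.k = n := by
  obtain ⟨x, hx, -, -⟩ := ht'
  refine ⟨x ≫ inv e.fD, ?_⟩
  rw [← cancel_mono f, Category.assoc, Category.assoc, e.pushout_left.w, IsIso.inv_hom_id_assoc,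
    hx, hn]

variable [HasBinaryCoproducts C]

theorem coproductPair_isSumWith_right (p₁ p₂ : PlainRule M) :
    (coproductPair p₁ p₂).t₂.IsSumWith (coproductPair p₁ p₂).t₁.m := by
  refine ⟨(coprod.inl : p₁.L ⟶ p₁.L ⨿ p₂.I), ?_, ?_, ?_⟩
  · change (coprod.inl : p₁.L ⟶ p₁.L ⨿ p₂.I) ≫ coprod.map (𝟙 p₁.L) p₂.l = coprod.inl
    simp
  · intro S f g
    refine ⟨(coprod.desc f g : p₁.L ⨿ p₂.R ⟶ S), ?_, coprod.inr_desc f g⟩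
    change (coprod.inl : p₁.L ⟶ p₁.L ⨿ p₂.I) ≫ coprod.map (𝟙 p₁.L) p₂.r ≫ coprod.desc f g = f
    rw [coprod.inl_map_assoc, Category.id_comp, coprod.inl_desc]
  · intro S (y : p₁.L ⨿ p₂.R ⟶ S) (y' : p₁.L ⨿ p₂.R ⟶ S)
    change ((coprod.inl : p₁.L ⟶ p₁.L ⨿ p₂.I) ≫ coprod.map (𝟙 p₁.L) p₂.r ≫ y =
      coprod.inl ≫ coprod.map (𝟙 p₁.L) p₂.r ≫ y') → coprod.inr ≫ y = coprod.inr ≫ y' → y = y'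
    rw [coprod.inl_map_assoc, coprod.inl_map_assoc, Category.id_comp, Category.id_comp]
    exact coprod.hom_ext

theorem coproductPair_isSumWith_left (p₁ p₂ : PlainRule M) :
    (coproductPair p₁ p₂).t₁.IsSumWith (coproductPair p₁ p₂).t₂.m := by
  refine ⟨(coprod.inr : p₂.L ⟶ p₁.I ⨿ p₂.L), ?_, ?_, ?_⟩
  · change (coprod.inr : p₂.L ⟶ p₁.I ⨿ p₂.L) ≫ coprod.map p₁.l (𝟙 p₂.L) = coprod.inr
    simp
  · intro S f g
    refine ⟨(coprod.desc g f : p₁.R ⨿ p₂.L ⟶ S), ?_, coprod.inl_desc g f⟩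
    change (coprod.inr : p₂.L ⟶ p₁.I ⨿ p₂.L) ≫ coprod.map p₁.r (𝟙 p₂.L) ≫ coprod.desc g f = f
    rw [coprod.inr_map_assoc, Category.id_comp, coprod.inr_desc]
  · intro S (y : p₁.R ⨿ p₂.L ⟶ S) (y' : p₁.R ⨿ p₂.L ⟶ S)
    change ((coprod.inr : p₂.L ⟶ p₁.I ⨿ p₂.L) ≫ coprod.map p₁.r (𝟙 p₂.L) ≫ y =
      coprod.inr ≫ coprod.map p₁.r (𝟙 p₂.L) ≫ y') → coprod.inl ≫ y = coprod.inl ≫ y' → y = y'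
    rw [coprod.inr_map_assoc, coprod.inr_map_assoc, Category.id_comp, Category.id_comp]
    exact fun h h' => coprod.hom_ext h' h

/-- This rules out the coproduct alternative for an initial conflict whose plain pair is dependent.
-/
theorem plainParallelIndependent_of_isomorphic_coproductPair {tp : TransformationPair p₁ p₂}
    (h : Isomorphic tp (coproductPair p₁ p₂)) : PlainParallelIndependent tp := by
  obtain ⟨e, hf, hD₁, -, hD₂, -⟩ := h
  exact ⟨(coproductPair_isSumWith_right p₁ p₂).exists_preserved e.e₂ e.e₁.comm_m,
    (coproductPair_isSumWith_left p₁ p₂).exists_preserved e.e₁ e.e₂.comm_m⟩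

end Coproducts

end InitialConflicts

namespace InitialConflicts

variable {C : Type u} [Category.{v} C] {M : MorphismProperty C} {E' : PairClass C}
  {ρ₁ ρ₂ : Rule M} {F₁ : ArrowFamily ρ₁.L} {F₂ : ArrowFamily ρ₂.L}

/-! ## Regularity -/

section Regularity

theorem sat_acK_iff (hF₁ : ρ₁.ac = F₁.nacs) (hF₂ : ρ₂.ac = F₂.nacs)
    (stp : SymbolicTransformationPair E' ρ₁ ρ₂) {G : C} (p : stp.tp.G ⟶ G) :
    stp.acK.Sat M p ↔ (extensionNACs stp F₁ F₂).nacs.Sat M p := by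
  rw [stp.acK_eq, extensionAC, AC.sat_and, hF₁, hF₂, ArrowFamily.sat_shift_nacs,
    ArrowFamily.sat_shift_nacs, ← ArrowFamily.sat_nacs_union, extensionNACs]

variable [MAdhesive M]

theorem sat_acKstar_iff (hE : HasPairFactorization E' M) (hF₁ : ρ₁.ac = F₁.nacs)
    (hF₂ : ρ₂.ac = F₂.nacs) (stp : SymbolicTransformationPair E' ρ₁ ρ₂) {G : C}
    (p : stp.tp.G ⟶ G) :
    stp.acKstar.Sat M p ↔
      ∃ (i : (conflictPACs stp F₁ F₂).J) (q : (conflictPACs stp F₁ F₂).N i ⟶ G), M q ∧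
        (conflictPACs stp F₁ F₂).n i ≫ q = p := by
  rw [stp.acKstar_eq, conflictInducingAC, AC.sat_neg, AC.sat_and]
  by_cases h : (∃ d₁₂ : ρ₁.L ⟶ stp.tp.t₂.D, d₁₂ ≫ stp.tp.t₂.k = stp.tp.t₁.m) ∧
      (∃ d₂₁ : ρ₂.L ⟶ stp.tp.t₁.D, d₂₁ ≫ stp.tp.t₁.k = stp.tp.t₂.m)
  · have hA : conflictPACs stp F₁ F₂ = _ := dif_pos h
    rw [hA, dif_pos h.1, dif_pos h.2, hF₁, hF₂, ArrowFamily.sat_left_shift_nacs,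
      ArrowFamily.sat_left_shift_nacs, ← ArrowFamily.sat_nacs_union, ArrowFamily.sat_nacs]
    simp only [not_forall, not_not]
  · have hA : conflictPACs stp F₁ F₂ = _ := dif_neg h
    rw [hA]
    -- One of the two conjuncts is `AC.ff`, so its negated conjunction is true.
    refine iff_of_true ?_ ?_
    · rintro ⟨hs₁, hs₂⟩
      split_ifs at hs₁ with h₁
      · rw [dif_neg fun h₂ => h ⟨h₁, h₂⟩] at hs₂
        exact AC.not_sat_ff p hs₂
      · exact AC.not_sat_ff p hs₁
    · obtain ⟨X, e, m, he, hm, hp⟩ := exists_quotient_factorization hE p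
      exact ⟨⟨X, e, he⟩, m, hm, hp⟩

/-- The remainder NACs hold at `q` exactly when the extension AC holds at the PAC morphism followed
by `q`, by `AC.sat_shift`. -/
theorem sat_nacLiteral_iff (hE : HasPairFactorization E' M) (hF₁ : ρ₁.ac = F₁.nacs)
    (hF₂ : ρ₂.ac = F₂.nacs) (stp : SymbolicTransformationPair E' ρ₁ ρ₂)
    (i : NACLiteralIndex stp F₁ F₂) {G : C} (p : stp.tp.G ⟶ G) :
    (nacLiterals stp F₁ F₂ i).toAC.Sat M p ↔ stp.acK.Sat M p ∧
      ∃ q : (conflictPACs stp F₁ F₂).N i.1 ⟶ G, M q ∧ (conflictPACs stp F₁ F₂).n i.1 ≫ q = p := by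
  have key : ∀ q : (conflictPACs stp F₁ F₂).N i.1 ⟶ G,
      (remainder stp F₁ F₂ i.1).nacs.Sat M q ↔
        stp.acK.Sat M ((conflictPACs stp F₁ F₂).n i.1 ≫ q) := fun q => by
    rw [sat_acK_iff hF₁ hF₂, remainder, ← ArrowFamily.sat_shift_nacs, AC.sat_shift hE]
  constructor
  · rintro ⟨q, hq, rfl, h⟩
    exact ⟨(key q).1 h, q, hq, rfl⟩
  · rintro ⟨h, q, hq, rfl⟩
    exact ⟨q, hq, rfl, (key q).2 h⟩

theorem equivalent_disj_nacLiterals (hE : HasPairFactorization E' M) (hF₁ : ρ₁.ac = F₁.nacs)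
    (hF₂ : ρ₂.ac = F₂.nacs) (stp : SymbolicTransformationPair E' ρ₁ ρ₂) :
    AC.Equivalent M (stp.acK.and stp.acKstar)
      (AC.disj _ fun i => (nacLiterals stp F₁ F₂ i).toAC) := by
  intro G p
  rw [AC.sat_and, AC.sat_disj]
  constructor
  · rintro ⟨h, hs⟩
    obtain ⟨i, q, hq, rfl⟩ := (sat_acKstar_iff hE hF₁ hF₂ stp p).1 hs
    refine ⟨⟨i, fun j hj => ?_⟩, (sat_nacLiteral_iff hE hF₁ hF₂ stp _ _).2 ⟨h, q, hq, rfl⟩⟩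
    rw [sat_acK_iff hF₁ hF₂, ← AC.sat_shift hE, ArrowFamily.sat_shift_nacs] at h
    exact (remainder stp F₁ F₂ i).not_sat_nacs_of_isIso j hj hq h
  · rintro ⟨i, h⟩
    obtain ⟨h, q, hq, rfl⟩ := (sat_nacLiteral_iff hE hF₁ hF₂ stp _ _).1 h
    exact ⟨h, (sat_acKstar_iff hE hF₁ hF₂ stp _).2 ⟨i.1, q, hq, rfl⟩⟩

/-- The extension morphism into a conflict satisfies the extension and the conflict-inducing
condition. -/
theorem sat_acK_and_acKstar_of_isConflict (hE : HasPairFactorization E' M)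
    (stp : SymbolicTransformationPair E' ρ₁ ρ₂)
    {tp : TransformationPair ρ₁.toPlainRule ρ₂.toPlainRule} (htp : IsConflict ρ₁ ρ₂ tp)
    (e : Embedding stp.tp tp) : (stp.acK.and stp.acKstar).Sat M e.f := by
  rw [AC.sat_and, stp.acK_eq, stp.acKstar_eq, extensionAC, conflictInducingAC, AC.sat_and,
    AC.sat_shift hE, AC.sat_shift hE, e.e₁.comm_m, e.e₂.comm_m, AC.sat_neg, AC.sat_and]
  -- If both shifted conditions held, carrying them forward along the extension diagrams would make
  -- the conflict parallel independent.
  refine ⟨htp.1, fun ⟨hs₁, hs₂⟩ => htp.2 ⟨?_, ?_⟩⟩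
  · split_ifs at hs₁ with h
    · rw [AC.sat_left _ stp.tp.t₂.mem_k stp.tp.t₂.mem_c e.e₂.pushout_left e.e₂.pushout_right,
        AC.sat_shift hE, Category.assoc, e.e₂.pushout_right.w, ← Category.assoc] at hs₁
      refine ⟨_, ?_, hs₁⟩
      rw [Category.assoc, ← e.e₂.pushout_left.w, ← Category.assoc, h.choose_spec, e.e₁.comm_m]
    · exact (AC.not_sat_ff _ hs₁).elim
  · split_ifs at hs₂ with h
    · rw [AC.sat_left _ stp.tp.t₁.mem_k stp.tp.t₁.mem_c e.e₁.pushout_left e.e₁.pushout_right,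
        AC.sat_shift hE, Category.assoc, e.e₁.pushout_right.w, ← Category.assoc] at hs₂
      refine ⟨_, ?_, hs₂⟩
      rw [Category.assoc, ← e.e₁.pushout_left.w, ← Category.assoc, h.choose_spec, e.e₂.comm_m]
    · exact (AC.not_sat_ff _ hs₂).elim

theorem isRegularDecomposition_nacLiterals (hE : HasPairFactorization E' M)
    (hF₁ : ρ₁.ac = F₁.nacs) (hF₂ : ρ₂.ac = F₂.nacs) (stp : SymbolicTransformationPair E' ρ₁ ρ₂)
    (hstp : IsConflictInducing stp) : IsRegularDecomposition stp (nacLiterals stp F₁ F₂) := by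
  have heq := equivalent_disj_nacLiterals hE hF₁ hF₂ stp
  refine ⟨?_, fun i j => i.2 j, heq⟩
  obtain ⟨tp, ⟨-, ⟨e⟩⟩, htp⟩ := hstp
  have h := (heq e.f).1 (sat_acK_and_acKstar_of_isConflict hE stp htp e)
  rw [AC.sat_disj] at h
  exact ⟨h.choose⟩

end Regularity

/-! ## The disjunctive unfolding -/

section CriticalPairs

variable [MAdhesive M]

/-- The legs `k` are mono, so the morphisms `h₁₂` and `h₂₁` are unique; each clause thus refutes one
half of parallel independence. -/
theorem IsNACCriticalPair.isConflict (hF₁ : ρ₁.ac = F₁.nacs) (hF₂ : ρ₂.ac = F₂.nacs)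
    {tp : TransformationPair ρ₁.toPlainRule ρ₂.toPlainRule}
    (h : IsNACCriticalPair E' F₁ F₂ tp) : IsConflict ρ₁ ρ₂ tp := by
  obtain ⟨hs, h⟩ := h
  refine ⟨by rwa [SatisfiesACs, hF₁, hF₂], ?_⟩
  rintro ⟨⟨d₁₂, hd₁₂, hac₁⟩, ⟨d₂₁, hd₂₁, hac₂⟩⟩
  have := mono_of_mem tp.t₁.mem_k
  have := mono_of_mem tp.t₂.mem_k
  rw [hF₁, ArrowFamily.sat_nacs] at hac₁
  rw [hF₂, ArrowFamily.sat_nacs] at hac₂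
  obtain ⟨h, -⟩ | ⟨h₁₂, hh, j, q, hq, hn, -⟩ | ⟨h, -⟩ | ⟨h₂₁, hh, j, q, hq, hn, -⟩ := h
  · exact h ⟨d₁₂, hd₁₂⟩
  · obtain rfl : h₁₂ = d₁₂ := by rw [← cancel_mono tp.t₂.k, hh, hd₁₂]
    exact hac₁ j ⟨q, hq, hn⟩
  · exact h ⟨d₂₁, hd₂₁⟩
  · obtain rfl : h₂₁ = d₂₁ := by rw [← cancel_mono tp.t₁.k, hh, hd₂₁]
    exact hac₂ j ⟨q, hq, hn⟩

/-- Direct transformations at the same match have isomorphic derived spans. -/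
theorem DirectTransformation.exists_iso {p : PlainRule M} {G D H : C}
    (t : DirectTransformation p G) {m : p.L ⟶ G} {d : p.I ⟶ D} {k : D ⟶ G} {m' : p.R ⟶ H}
    {c : D ⟶ H} (sq : IsPushout p.l d m k) (sq' : IsPushout p.r d m' c) (hm : t.m = m) :
    ∃ (φ : D ≅ t.D) (ψ : H ≅ t.H), φ.hom ≫ t.k = k ∧ m' ≫ ψ.hom = t.m' ∧
      c ≫ ψ.hom = φ.hom ≫ t.c := by
  subst hm
  obtain ⟨φ, hφ, hφ'⟩ := exists_iso_of_isPushout sq p.mem_l t.pushout_left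
  have sq'' : IsPushout p.r (d ≫ φ.hom) t.m' t.c := by rw [hφ]; exact t.pushout_right
  have po := IsPushout.of_top' sq'' sq'
  have := po.isIso_inl_of_isIso
  exact ⟨φ, asIso (sq'.desc _ _ _), hφ', sq'.inl_desc _ _ _, sq'.inr_desc _ _ _⟩

theorem mem_E'_of_isPlainInitialConflict (hE : HasPairFactorization E' M) {p₁ p₂ : PlainRule M}
    {tp : TransformationPair p₁ p₂} (h : IsPlainInitialConflict tp) : E' tp.t₁.m tp.t₂.m := by
  obtain ⟨-, tpI, hI, hiso⟩ := h
  rw [mem_E'_iff hE]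
  exact fun S s m₁ m₂ hs h₁ h₂ => isIso_of_isInitialFor hI hiso hs m₁ m₂ h₁ h₂

/-- An extension of a pair in which the second transformation does not touch the match of the first
produces a forbidden pattern if the extension arises by shifting the forbidden pattern. -/
theorem exists_forbidden_of_derivedSpan (hE : HasPairFactorization E' M) {p : PlainRule M}
    {K G' L N : C} {t : DirectTransformation p K} {t' : DirectTransformation p G'} {o : L ⟶ K}
    {n' : L ⟶ G'} (ht' : t'.IsSumWith n') {f : K ⟶ G'} (e : ExtensionDiagram t t' f) [IsIso e.fH]
    (hn' : o ≫ f = n') {d : L ⟶ t.D} (hd : d ≫ t.k = o) {n : L ⟶ N}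
    (s : ShiftSquare E' M (d ≫ t.c) n) (ds : DerivedSpan t.k t.c s.a')
    (t₀ : DirectTransformation p ds.Y) (h₀ : t₀.m = t.m ≫ ds.b) :
    ∃ h : L ⟶ t₀.D, h ≫ t₀.k = o ≫ ds.b ∧ ∃ q : N ⟶ t₀.H, M q ∧ n ≫ q = h ≫ t₀.c ∧
      E' q t₀.m' := by
  -- Pasting `t` with the derived span gives a double pushout at the match of `t₀`, so everything
  -- can be computed there.
  obtain ⟨φ, ψ, hk, hm', hc⟩ := t₀.exists_iso (t.pushout_left.paste_vert ds.left)
    (t.pushout_right.paste_vert ds.right) h₀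
  refine ⟨d ≫ ds.z ≫ φ.hom, ?_, s.b' ≫ ψ.hom, (M.cancel_right_of_respectsIso _ _).2 s.mem_M, ?_, ?_⟩
  · rw [Category.assoc, Category.assoc, hk, ← ds.left.w, ← Category.assoc, hd]
  · rw [← Category.assoc, s.comm, Category.assoc, Category.assoc, ds.right.w_assoc, hc]
    simp only [Category.assoc]
  · rw [← hm']
    refine hE.comp_iso _ _ _ ?_
    rw [mem_E'_iff hE]
    intro S m f' g' hm hf hg
    -- The component on `L` lies in the subobject because it passes through the pattern `N`; the
    -- component on `p.R` does because the comatch does.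
    obtain ⟨y, hy⟩ := ht'.exists_factor e (by rw [← Category.assoc, hd, hn'])
      (u := n ≫ f') (by rw [Category.assoc, hf, s.comm, Category.assoc]) hg
    exact (mem_E'_iff hE _ _).1 s.mem_E' m y f' hm hy hf

/-- Plain independence decides which alternative of an initial conflict applies: an independent pair
is the coproduct pair and leads to the forbid clauses, a dependent one is a plain initial conflict
and leads to the delete clauses. -/
theorem isNACCriticalPair_of_conflictPACs [HasBinaryCoproducts C]
    (hE : HasPairFactorization E' M) (hF₁ : ρ₁.ac = F₁.nacs) (hF₂ : ρ₂.ac = F₂.nacs)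
    (stp : SymbolicTransformationPair E' ρ₁ ρ₂)
    (hstp : IsPlainInitialConflict stp.tp ∨
      Isomorphic stp.tp (coproductPair ρ₁.toPlainRule ρ₂.toPlainRule))
    (i : (conflictPACs stp F₁ F₂).J)
    (t₁ : DirectTransformation ρ₁.toPlainRule ((conflictPACs stp F₁ F₂).N i))
    (t₂ : DirectTransformation ρ₂.toPlainRule ((conflictPACs stp F₁ F₂).N i))
    (h₁ : t₁.m = stp.tp.t₁.m ≫ (conflictPACs stp F₁ F₂).n i)
    (h₂ : t₂.m = stp.tp.t₂.m ≫ (conflictPACs stp F₁ F₂).n i)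
    (hs : SatisfiesACs ρ₁ ρ₂ ⟨_, t₁, t₂⟩) : IsNACCriticalPair E' F₁ F₂ ⟨_, t₁, t₂⟩ := by
  refine ⟨⟨hF₁ ▸ hs.1, hF₂ ▸ hs.2⟩, ?_⟩
  clear hs
  by_cases h : (∃ d₁₂ : ρ₁.L ⟶ stp.tp.t₂.D, d₁₂ ≫ stp.tp.t₂.k = stp.tp.t₁.m) ∧
      (∃ d₂₁ : ρ₂.L ⟶ stp.tp.t₁.D, d₂₁ ≫ stp.tp.t₁.k = stp.tp.t₂.m)
  · obtain ⟨e, -, -, hH₁, -, hH₂⟩ := hstp.resolve_left fun hp => hp.1 h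
    have hA : conflictPACs stp F₁ F₂ = _ := dif_pos h
    generalize conflictPACs stp F₁ F₂ = A at *
    subst hA
    obtain ⟨⟨j, s⟩, hs⟩ | ⟨⟨j, s⟩, hs⟩ := i
    · obtain ⟨h₁₂, hk, q, hq, hn, hE'⟩ := exists_forbidden_of_derivedSpan hE
        (coproductPair_isSumWith_right _ _) e.e₂ e.e₁.comm_m h.1.choose_spec s hs.some t₂ h₂
      exact Or.inr (Or.inl ⟨h₁₂, hk.trans h₁.symm, j, q, hq, hn, hE'⟩)
    · obtain ⟨h₂₁, hk, q, hq, hn, hE'⟩ := exists_forbidden_of_derivedSpan hE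
        (coproductPair_isSumWith_left _ _) e.e₁ e.e₂.comm_m h.2.choose_spec s hs.some t₁ h₁
      exact Or.inr (Or.inr (Or.inr ⟨h₂₁, hk.trans h₂.symm, j, q, hq, hn, hE'⟩))
  · have hp := hstp.resolve_right fun hc =>
      h (plainParallelIndependent_of_isomorphic_coproductPair hc)
    have hA : conflictPACs stp F₁ F₂ = _ := dif_neg h
    generalize conflictPACs stp F₁ F₂ = A at *
    subst hA
    obtain ⟨X, a, ha⟩ := i
    have hE' : E' t₁.m t₂.m := by
      rw [h₁, h₂]
      exact comp_mem_E'_of_quotient hE (mem_E'_of_isPlainInitialConflict hE hp) ha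
    rw [not_and_or] at h
    refine h.elim (fun h => Or.inl ⟨?_, hE'⟩) fun h => Or.inr (Or.inr (Or.inl ⟨?_, hE'⟩))
    · rintro ⟨h₁₂, hk⟩
      exact h (exists_factor_of_isPushout stp.tp.t₂.pushout_left ρ₂.mem_l
        (h₂ ▸ t₂.pushout_left) _ h₁₂ (hk.trans h₁))
    · rintro ⟨h₂₁, hk⟩
      exact h (exists_factor_of_isPushout stp.tp.t₁.pushout_left ρ₁.mem_l
        (h₁ ▸ t₁.pushout_left) _ h₂₁ (hk.trans h₂))

end CriticalPairs

end InitialConflicts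

theorem mainTheorem7 {C : Type u} [Category.{v} C] (M : MorphismProperty C) [MAdhesive M]
    (E' : PairClass C) (hE : HasPairFactorization E' M) [HasBinaryCoproducts C]
    (R : Set (Rule M)) (hR : HasInitialTransformationPairs R)
    (ρ₁ ρ₂ : Rule M) (h₁ : ρ₁ ∈ R) (h₂ : ρ₂ ∈ R)
    (F₁ : ArrowFamily ρ₁.L) (F₂ : ArrowFamily ρ₂.L) [Finite F₁.J] [Finite F₂.J]
    (hF₁ : ρ₁.ac = F₁.nacs) (hF₂ : ρ₂.ac = F₂.nacs)
    (stp : SymbolicTransformationPair E' ρ₁ ρ₂) (hstp : IsInitialConflict stp) :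
    IsRegularDecomposition stp (nacLiterals stp F₁ F₂) ∧
      ∀ tp ∈ disjunctiveUnfolding stp (nacLiterals stp F₁ F₂),
        IsConflict ρ₁ ρ₂ tp ∧ IsNACCriticalPair E' F₁ F₂ tp := by
  refine ⟨isRegularDecomposition_nacLiterals hE hF₁ hF₂ stp hstp.1, ?_⟩
  rintro _ ⟨hs, i, t₁, t₂, hm₁, hm₂, rfl⟩
  have h := isNACCriticalPair_of_conflictPACs hE hF₁ hF₂ stp hstp.2 i.1 t₁ t₂ hm₁ hm₂ hs
  exact ⟨h.isConflict hF₁ hF₂, h⟩
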